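/- Let $X$ be a topological space. A continuous closed 1-form $\omega$ on $X$ is a collection $\{f_U\}_{U\in\mathcal U}$, where $\mathcal U$ is an open cover of $X$, each $f_U:U\to\mathbb R$ is continuous, and $f_U-f_V$ is locally constant on $U\cap V$ for all $U,V\in\mathcal U$. A continuous function $f:X\to\mathbb R$ defines the form $df$, given by the cover $\{X\}$ and the function $f$. A continuous flow on $X$ is a continuous map $(x,t)\mapsto x\cdot t$, $X\times\mathbb R\to X$, with $x\cdot 0=x$ and $(x\cdot s)\cdot t=x\cdot(s+t)$; a point $x$ is fixed if $x\cdot t=x$ for all $t$. The flow is gradient-like for $\omega=\{f_U\}$ if, for every $U\in\mathcal U$, every non-fixed point $x$ and all $s<t$ such that $x\cdot r\in U$ for all $r\in[s,t]$, one has $f_U(x\cdot t)<f_U(x\cdot s)$. A point $p\in X$ is a zero of $\omega$ if $p$ is fixed by every gradient-like flow of $\omega$. **Lemma.** (1) Let $M$ be a smooth manifold (finite-dimensional, Hausdorff, second countable, without boundary), let $f:M\to\mathbb R$ be a Morse function, that is, a $C^\infty$ function all of whose critical points are nondegenerate, and let $p$ be a nondegenerate critical point of $f$. Then $p$ is a zero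 of the continuous closed 1-form $df$; that is, $p$ is fixed by every continuous gradient-like flow of $df$. (2) Let $X$ be a topological space, $f:X\to\mathbb R$ a continuous function and $p\in X$ a local maximum or local minimum point of $f$. Then $p$ is a zero of $df$. -/

import Mathlib

open scoped Manifold ContDiff
open TopologicalSpace

/-- A continuous closed 1-form on a topological space: an open cover together with a continuous
real function on each member of the cover, such that on every overlap the difference of the two
functions is locally constant. -/
structure ContinuousClosedOneForm (X : Type*) [TopologicalSpace X] where
  /-- the open cover -/
  cover : Set (Opens X)
  covers : ∀ x : X, ∃ U ∈ cover, x ∈ U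
  /-- the local primitives -/
  primitive : ∀ U ∈ cover, C(U, ℝ)
  compatible : ∀ (U : Opens X) (hU : U ∈ cover) (V : Opens X) (hV : V ∈ cover),
    IsLocallyConstant (fun x : (U ⊓ V : Opens X) =>
      primitive U hU ⟨x.1, x.2.1⟩ - primitive V hV ⟨x.1, x.2.2⟩)

namespace ContinuousClosedOneForm

variable {X : Type*} [TopologicalSpace X]

/-- The form `df` of a continuous function `f`, given by the cover `{X}` and the function `f`. -/
def d (f : C(X, ℝ)) : ContinuousClosedOneForm X where
  cover := {⊤}
  covers x := ⟨⊤, rfl, trivial⟩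
  primitive U _ := f.restrict (U : Set X)
  compatible U _ V _ := by
    have h : (fun x : (U ⊓ V : Opens X) =>
        f.restrict (U : Set X) ⟨x.1, x.2.1⟩ - f.restrict (V : Set X) ⟨x.1, x.2.2⟩)
        = fun _ => (0 : ℝ) := by
      funext x
      exact sub_self (f x.1)
    rw [h]
    exact IsLocallyConstant.const 0

/-- `x` is a fixed point of the flow `φ`. -/
def IsFixedPoint (φ : Flow ℝ X) (x : X) : Prop := ∀ t : ℝ, φ t x = x

/-- A continuous flow is gradient-like for `α` if each local primitive `f_U` is strictly decreasing
along the pieces of non-constant orbits that stay in `U`. -/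
def IsGradientLike (α : ContinuousClosedOneForm X) (φ : Flow ℝ X) : Prop :=
  ∀ (U : Opens X) (hU : U ∈ α.cover) (x : X), ¬ IsFixedPoint φ x →
    ∀ (s t : ℝ) (hst : s < t) (h : ∀ r ∈ Set.Icc s t, φ r x ∈ U),
      α.primitive U hU ⟨φ t x, h t (Set.right_mem_Icc.2 hst.le)⟩
        < α.primitive U hU ⟨φ s x, h s (Set.left_mem_Icc.2 hst.le)⟩

/-- `p` is a zero of `α` if it is a fixed point of every gradient-like flow of `α`. -/
def IsZero (α : ContinuousClosedOneForm X) (p : X) : Prop :=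
  ∀ φ : Flow ℝ X, α.IsGradientLike φ → IsFixedPoint φ p

end ContinuousClosedOneForm

section Morse

variable {n : ℕ} {M : Type*} [TopologicalSpace M] [ChartedSpace (EuclideanSpace ℝ (Fin n)) M]

/-- The matrix of second derivatives (as a bilinear form) of `f` at `p`, read in the preferred
chart at `p`. At a critical point its nondegeneracy does not depend on the chart. -/
noncomputable def chartHessian (f : M → ℝ) (p : M) :
    EuclideanSpace ℝ (Fin n) →L[ℝ] EuclideanSpace ℝ (Fin n) →L[ℝ] ℝ :=
  fderiv ℝ (fderiv ℝ (f ∘ (extChartAt (𝓡 n) p).symm)) (extChartAt (𝓡 n) p p)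

variable (n) in
/-- `p` is a critical point of `f`: the differential of `f` vanishes at `p`. -/
def IsCriticalPoint (f : M → ℝ) (p : M) : Prop :=
  mfderiv (𝓡 n) 𝓘(ℝ, ℝ) f p = 0

variable (n) in
/-- `p` is a nondegenerate (Morse) critical point of `f`. -/
def IsNondegenerateCriticalPoint (f : M → ℝ) (p : M) : Prop :=
  IsCriticalPoint n f p ∧
    ∀ v : EuclideanSpace ℝ (Fin n), (∀ w, chartHessian f p v w = 0) → v = 0

variable (n) in
/-- A Morse function: a smooth function all of whose critical points are nondegenerate. -/
structure IsMorseFunction (f : M → ℝ) : Prop where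
  smooth : ContMDiff (𝓡 n) 𝓘(ℝ, ℝ) ∞ f
  nondegenerate : ∀ p : M, IsCriticalPoint n f p → IsNondegenerateCriticalPoint n f p

end Morse

/-! ### Volume of the ball under perturbations of the identity. -/

section NoRetraction

open Set Metric MeasureTheory Polynomial
open scoped NNReal RealInnerProductSpace

/-! For (2), a non-fixed extremum is impossible: `f` would be larger than `f p` just before time 0
and smaller just after.

For (1), the Hessian splits the chart space into `N`, on which it is negative definite, and `Nᗮ`, on
which it is positive definite. Near `p`, Taylor expansion gives `f ≤ f p` on the slice along `N` and
`f ≥ f p` on the slice along `Nᗮ`. If `p` were not fixed, no nearby point would be. For small `t >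
0` the flow barely moves the `N`-slice, so the `N`-component of the moved slice is close to the
identity and vanishes somewhere, by Brouwer. There a non-fixed point with `f ≤ f p` flows to one
with `f ≥ f p`, contradicting strict decrease (`isZero_d_of_chart`).

Brouwer's theorem follows from the absence of a `C¹` retraction `r` onto the sphere. The integral
over the ball of the Jacobian of `x + t (r x - x)` is polynomial in `t` and equals the volume for
small `t > 0`, hence also at `t = 1`; but a retraction has Jacobian zero. -/

theorem LinearMap.exists_polynomial_eval_eq_det_one_add_smul {R V : Type*} [Field R]
    [AddCommGroup V] [Module R V] [FiniteDimensional R V] (A : V →ₗ[R] V) :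
    ∃ P : R[X], P.natDegree ≤ Module.finrank R V ∧
      ∀ t, P.eval t = LinearMap.det (1 + t • A) := by
  classical
  let b := Module.finBasis R V
  let B := LinearMap.toMatrix b b A
  refine ⟨Matrix.det ((X : R[X]) • B.map C + (1 : Matrix _ _ R).map C), ?_, fun t => ?_⟩
  · simpa using natDegree_det_X_add_C_le B 1
  · have h : LinearMap.toMatrix b b (1 + t • A) = 1 + t • B := by
      simp [B, LinearMap.toMatrix_one]
    rw [← LinearMap.det_toMatrix b, h, ← coe_evalRingHom, RingHom.map_det]
    congr 1
    ext i j
    by_cases hij : i = j <;> simp [hij, B, add_comm, mul_comm t]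

/-- A function of `t` that is an average of polynomials of bounded degree and takes the value `c`
at sufficiently many points takes the value `c` everywhere. -/
theorem integral_eval_eq_of_forall_node {α : Type*} [MeasurableSpace α] {μ : Measure α} {n : ℕ}
    {P : α → ℝ[X]} (hP : ∀ a, (P a).natDegree ≤ n) {node : ℕ → ℝ} (hnode : node.Injective)
    {c : ℝ} (hint : ∀ i, Integrable (fun a => (P a).eval (node i)) μ)
    (hc : ∀ i, ∫ a, (P a).eval (node i) ∂μ = c) (t : ℝ) : ∫ a, (P a).eval t ∂μ = c := by
  have hinj : Set.InjOn node (Finset.range (n + 1)) := hnode.injOn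
  -- Lagrange interpolation expresses the value at `t` through the values at fixed nodes, so only
  -- those values need be integrable; the weights sum to 1.
  have key : ∀ a, (P a).eval t = ∑ i ∈ Finset.range (n + 1),
      (P a).eval (node i) * (Lagrange.basis (Finset.range (n + 1)) node i).eval t := by
    intro a
    have h : P a = Lagrange.interpolate (Finset.range (n + 1)) node
        (fun i => (P a).eval (node i)) := by
      refine Lagrange.eq_interpolate_of_eval_eq _ hinj ?_ (fun _ _ => rfl)
      rw [Finset.card_range]
      exact degree_le_natDegree.trans_lt (by exact_mod_cast Nat.lt_succ_of_le (hP a))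
    conv_lhs => rw [h]
    simp [Lagrange.interpolate_apply, eval_finsetSum]
  simp_rw [key]
  rw [integral_finsetSum _ (fun i _ => (hint i).mul_const _)]
  simp_rw [integral_mul_const, hc, ← Finset.mul_sum, ← eval_finsetSum]
  rw [Lagrange.sum_basis hinj (by simp)]
  simp

/-- A segment leaving the ball crosses the sphere, where `v` vanishes, so extension by zero keeps
the Lipschitz constant. -/
theorem LipschitzOnWith.lipschitzWith_indicator_closedBall {E F : Type*} [NormedAddCommGroup E]
    [NormedSpace ℝ E] [NormedAddCommGroup F] {v : E → F} {K : ℝ≥0} {R : ℝ}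
    (hv : LipschitzOnWith K v (closedBall 0 R)) (h0 : ∀ x ∈ sphere (0 : E) R, v x = 0) :
    LipschitzWith K ((closedBall (0 : E) R).indicator v) := by
  have mixed : ∀ x ∈ closedBall (0 : E) R, ∀ y ∉ closedBall (0 : E) R,
      dist (v x) 0 ≤ K * dist x y := by
    intro x hx y hy
    have hc : ContinuousOn (fun s : ℝ => ‖AffineMap.lineMap x y s‖) (Icc (0 : ℝ) 1) :=
      (AffineMap.lineMap_continuous.norm).continuousOn
    have hR : R ∈ Icc ‖AffineMap.lineMap x y (0 : ℝ)‖ ‖AffineMap.lineMap x y (1 : ℝ)‖ := by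
      simp only [mem_closedBall, dist_zero_right, not_le] at hx hy
      simpa using ⟨hx, hy.le⟩
    obtain ⟨s, hs, hsR⟩ := intermediate_value_Icc zero_le_one hc hR
    have hz : AffineMap.lineMap x y s ∈ sphere (0 : E) R := by simpa using hsR
    rw [← h0 _ hz]
    refine (hv.dist_le_mul x hx _ (sphere_subset_closedBall hz)).trans ?_
    gcongr
    rw [dist_left_lineMap, Real.norm_of_nonneg hs.1]
    exact mul_le_of_le_one_left dist_nonneg hs.2
  refine LipschitzWith.of_dist_le_mul fun x y => ?_
  by_cases hx : x ∈ closedBall (0 : E) R <;> by_cases hy : y ∈ closedBall (0 : E) R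
  · rw [indicator_of_mem hx, indicator_of_mem hy]
    exact hv.dist_le_mul x hx y hy
  · rw [indicator_of_mem hx, indicator_of_notMem hy]
    exact mixed x hx y hy
  · rw [indicator_of_notMem hx, indicator_of_mem hy, dist_comm, dist_comm x y]
    exact mixed y hy x hx
  · rw [indicator_of_notMem hx, indicator_of_notMem hy, dist_self]
    positivity

/-- A perturbation of the identity with Lipschitz constant less than one is bijective. -/
theorem LipschitzWith.bijective_id_add {E : Type*} [NormedAddCommGroup E] [NormedSpace ℝ E]
    [CompleteSpace E] {w : E → E} {c : ℝ≥0} (hw : LipschitzWith c w) (hc : c < 1) :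
    Function.Bijective (fun x => x + w x) := by
  have happ : ApproximatesLinearOn (fun x => x + w x)
      ((ContinuousLinearEquiv.refl ℝ E : E ≃L[ℝ] E) : E →L[ℝ] E) univ c := by
    rw [ApproximatesLinearOn.approximatesLinearOn_iff_lipschitzOnWith, lipschitzOnWith_univ]
    convert hw using 1
    ext x
    simp
  have hc' : Subsingleton E ∨
      c < ‖((ContinuousLinearEquiv.refl ℝ E).symm : E →L[ℝ] E)‖₊⁻¹ := by
    rcases subsingleton_or_nontrivial E with h | h
    · exact Or.inl h
    · right
      have : ‖((ContinuousLinearEquiv.refl ℝ E).symm : E →L[ℝ] E)‖₊ = 1 := by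
        have := ContinuousLinearMap.norm_id (𝕜 := ℝ) (E := E)
        exact NNReal.eq this
      rwa [this, inv_one]
  exact ⟨injOn_univ.1 (happ.injOn hc'), happ.surjective hc'⟩

variable {E : Type*} [NormedAddCommGroup E] [NormedSpace ℝ E] [FiniteDimensional ℝ E]

/-- Along the path `1 + s • A` from the identity the determinant cannot vanish: a kernel vector
would satisfy `‖x‖ ≤ ‖A‖ * ‖x‖ < ‖x‖`. -/
theorem ContinuousLinearMap.det_one_add_pos {A : E →L[ℝ] E} (hA : ‖A‖ < 1) :
    0 < (1 + A).det := by
  by_contra! hneg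
  have hc : ContinuousOn (fun s : ℝ => (1 + s • A).det) (Icc 0 1) := by
    refine (ContinuousLinearMap.continuous_det.comp ?_).continuousOn
    fun_prop
  have h0 : (0 : ℝ) ∈ Icc ((1 + (1 : ℝ) • A).det) ((1 + (0 : ℝ) • A).det) := by
    refine ⟨by simpa using hneg, ?_⟩
    simp [ContinuousLinearMap.det]
  obtain ⟨s, hs, hs0⟩ := intermediate_value_Icc' zero_le_one hc h0
  obtain ⟨x, hx, hx0⟩ := (LinearMap.det_eq_zero_iff_ker_ne_bot.1 hs0 |>
    Submodule.exists_mem_ne_zero_of_ne_bot)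
  have hx' : x = -(s • A x) := by
    rw [eq_neg_iff_add_eq_zero]
    simpa using hx
  have : ‖x‖ < ‖x‖ := by
    calc ‖x‖ = s * ‖A x‖ := by
          conv_lhs => rw [hx', norm_neg, norm_smul, Real.norm_of_nonneg hs.1]
      _ ≤ 1 * (‖A‖ * ‖x‖) := by
          gcongr
          · exact hs.2
          · exact A.le_opNorm x
      _ < ‖x‖ := by
          have := norm_pos_iff.2 hx0
          nlinarith
  exact lt_irrefl _ this

/-- If `v` is `C¹` on the closed ball and vanishes on the sphere, then for small `t` the map
`x ↦ x + t • v x` maps the ball bijectively to itself, and so preserves its volume. -/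
theorem exists_forall_integral_det_one_add_smul_eq [MeasurableSpace E] [BorelSpace E]
    (μ : Measure E) [μ.IsAddHaarMeasure] {v : E → E} {R : ℝ} (hR : 0 < R)
    (hv : ContDiffOn ℝ 1 v (closedBall 0 R)) (h0 : ∀ x ∈ sphere (0 : E) R, v x = 0) :
    ∃ ε : ℝ, 0 < ε ∧ ∀ t ∈ Ioc 0 ε,
      ∫ x in closedBall 0 R, (1 + t • fderivWithin ℝ v (closedBall 0 R) x).det ∂μ
        = μ.real (closedBall 0 R) := by
  set B := closedBall (0 : E) R with hB
  have hBconv : Convex ℝ B := convex_closedBall _ _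
  have hBc : IsCompact B := isCompact_closedBall _ _
  have hBu : UniqueDiffOn ℝ B := uniqueDiffOn_convex hBconv
    ⟨0, mem_interior_iff_mem_nhds.2 (closedBall_mem_nhds _ hR)⟩
  obtain ⟨K, hK⟩ := hv.exists_lipschitzOnWith one_ne_zero hBconv hBc
  have hw := hK.lipschitzWith_indicator_closedBall h0
  obtain ⟨D, hD⟩ := hBc.exists_bound_of_continuousOn
    (hv.continuousOn_fderivWithin hBu le_rfl)
  have hDK : 0 < 1 + |D| + K := by positivity
  -- This bound gives both `t * K < 1`, for bijectivity, and `t * |D| < 1`, for a positive Jacobian.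
  refine ⟨(1 + |D| + K)⁻¹, by positivity, fun t ht => ?_⟩
  have ht1 : t * (1 + |D| + K) ≤ 1 := by
    have := mul_le_mul_of_nonneg_right ht.2 hDK.le
    rwa [inv_mul_cancel₀ hDK.ne'] at this
  have ht0 := ht.1
  have hKt : (‖t‖₊ * K : ℝ≥0) < 1 := by
    rw [← NNReal.coe_lt_coe]
    simp only [NNReal.coe_mul, coe_nnnorm, NNReal.coe_one, Real.norm_of_nonneg ht0.le]
    nlinarith [abs_nonneg D]
  have hbij := LipschitzWith.bijective_id_add
    (w := fun x => t • B.indicator v x) (c := ‖t‖₊ * K)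
    ((lipschitzWith_smul t).comp hw) hKt
  set F : E → E := fun x => x + t • v x with hF
  have hFeq : EqOn (fun x => x + t • B.indicator v x) F B := fun x hx => by
    simp [hF, indicator_of_mem hx]
  have hout : ∀ x ∉ B, x + t • B.indicator v x = x := fun x hx => by
    simp [indicator_of_notMem hx]
  -- The extended map is a bijection of `E` fixing every point outside `B`, so it maps `B` onto `B`.
  have himage : F '' B = B := by
    rw [← hFeq.image_eq]
    have hcompl : (fun x => x + t • B.indicator v x) '' Bᶜ = Bᶜ := by
      exact (image_congr (g := id) (fun x hx => hout x hx)).trans (image_id _)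
    have := image_compl_eq (s := B) hbij
    rw [hcompl] at this
    exact (compl_injective this).symm
  have hinj : InjOn F B := hFeq.injOn_iff.1 hbij.1.injOn
  have hderiv : ∀ x ∈ B, HasFDerivWithinAt F (1 + t • fderivWithin ℝ v B x) B x := by
    intro x hx
    exact (hasFDerivWithinAt_id x B).add
      (((hv.differentiableOn one_ne_zero) x hx).hasFDerivWithinAt.const_smul t)
  have hcov := integral_image_eq_integral_abs_det_fderiv_smul μ
    (hBc.isClosed.measurableSet) hderiv hinj (fun _ => (1 : ℝ))
  rw [himage] at hcov
  simp only [smul_eq_mul, mul_one] at hcov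
  rw [setIntegral_const, smul_eq_mul, mul_one] at hcov
  rw [hcov]
  refine setIntegral_congr_fun hBc.isClosed.measurableSet fun x hx => ?_
  refine (abs_of_pos (ContinuousLinearMap.det_one_add_pos ?_)).symm
  rw [norm_smul, Real.norm_of_nonneg ht0.le]
  have := (hD x hx).trans (le_abs_self D)
  have hK0 : (0 : ℝ) ≤ K := K.2
  calc t * ‖fderivWithin ℝ v B x‖ ≤ t * |D| := by gcongr
    _ < 1 := by nlinarith [mul_nonneg ht0.le hK0]

/-- The volume of the ball is the integral of the Jacobian determinant of any `C¹` map that is the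
identity on the sphere. -/
theorem integral_det_fderivWithin_eq [MeasurableSpace E] [BorelSpace E]
    (μ : Measure E) [μ.IsAddHaarMeasure] {r : E → E} {R : ℝ} (hR : 0 < R)
    (hr : ContDiffOn ℝ 1 r (closedBall 0 R)) (h0 : ∀ x ∈ sphere (0 : E) R, r x = x) :
    ∫ x in closedBall 0 R, (fderivWithin ℝ r (closedBall 0 R) x).det ∂μ
        = μ.real (closedBall 0 R) := by
  set B := closedBall (0 : E) R with hB
  have hBc : IsCompact B := isCompact_closedBall _ _
  have hBu : UniqueDiffOn ℝ B := uniqueDiffOn_convex (convex_closedBall _ _)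
    ⟨0, mem_interior_iff_mem_nhds.2 (closedBall_mem_nhds _ hR)⟩
  have hv : ContDiffOn ℝ 1 (fun x => r x - x) B := hr.sub contDiffOn_id
  obtain ⟨ε, hε, hvol⟩ := exists_forall_integral_det_one_add_smul_eq μ hR hv
    (fun x hx => by rw [h0 x hx, sub_self])
  set A := fderivWithin ℝ (fun x => r x - x) B with hA
  have hcont : ContinuousOn A B := hv.continuousOn_fderivWithin hBu le_rfl
  choose P hPdeg hP using fun x =>
    LinearMap.exists_polynomial_eval_eq_det_one_add_smul (A x : E →ₗ[ℝ] E)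
  have hP' : ∀ x t, (P x).eval t = (1 + t • A x).det := fun x t => hP x t
  have hinj : Function.Injective (fun i : ℕ => ε / ((i : ℝ) + 1)) := by
    intro i j hij
    have hi : (i : ℝ) + 1 ≠ 0 := by positivity
    have hj : (j : ℝ) + 1 ≠ 0 := by positivity
    simp only at hij
    field_simp at hij
    exact_mod_cast (by linarith : (i : ℝ) = j)
  -- The nodes `ε / (i + 1)` are distinct points of `(0, ε]`; the value at `t = 1` is the Jacobian
  -- integral of `r` itself.
  have key := integral_eval_eq_of_forall_node (μ := μ.restrict B) hPdeg hinj
    (c := μ.real B) (fun i => ?_) (fun i => ?_) 1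
  · rw [← key]
    refine setIntegral_congr_fun hBc.isClosed.measurableSet fun x hx => ?_
    have hd := hr.differentiableOn one_ne_zero x hx
    have : A x = fderivWithin ℝ r B x - 1 := by
      exact (hd.hasFDerivWithinAt.sub (hasFDerivWithinAt_id x B)).fderivWithin (hBu x hx)
    simp only [hP', this]
    congr 1
    simp
  · simp_rw [hP']
    refine ContinuousOn.integrableOn_compact hBc ?_
    refine ContinuousLinearMap.continuous_det.comp_continuousOn
      (f := fun x => 1 + (ε / ((i : ℝ) + 1)) • A x) ?_
    fun_prop
  · simp_rw [hP']
    refine hvol _ ⟨by positivity, ?_⟩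
    exact div_le_self hε.le (by linarith [Nat.cast_nonneg (α := ℝ) i])

end NoRetraction

/-! ### Brouwer's fixed point theorem. -/

section Brouwer

open Set Metric MeasureTheory
open scoped RealInnerProductSpace

variable {E : Type*} [NormedAddCommGroup E] [InnerProductSpace ℝ E] [FiniteDimensional ℝ E]

/-- There is no `C¹` retraction of the closed unit ball to the unit sphere. -/
theorem not_contDiffOn_retraction_closedBall {r : E → E}
    (hr : ContDiffOn ℝ 1 r (closedBall 0 1)) (hnorm : ∀ x ∈ closedBall (0 : E) 1, ‖r x‖ = 1)
    (hid : ∀ x ∈ sphere (0 : E) 1, r x = x) : False := by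
  borelize E
  have h := integral_det_fderivWithin_eq (volume : Measure E) one_pos hr hid
  have hBu : UniqueDiffOn ℝ (closedBall (0 : E) 1) :=
    uniqueDiffOn_convex (convex_closedBall _ _)
      ⟨0, mem_interior_iff_mem_nhds.2 (closedBall_mem_nhds _ one_pos)⟩
  have hdet : ∀ x ∈ closedBall (0 : E) 1,
      (fderivWithin ℝ r (closedBall 0 1) x).det = 0 := by
    intro x hx
    by_contra hne
    set D := fderivWithin ℝ r (closedBall 0 1) x with hD
    have hd : HasFDerivWithinAt r D (closedBall 0 1) x :=
      (hr.differentiableOn one_ne_zero x hx).hasFDerivWithinAt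
    -- Since `‖r‖ ^ 2` is constant, the range of `D` is orthogonal to `r x`; an invertible `D` would
    -- reach the unit vector `r x`.
    have h1 := hd.norm_sq
    have h2 : HasFDerivWithinAt (fun y => ‖r y‖ ^ 2) (0 : E →L[ℝ] ℝ) (closedBall 0 1) x :=
      (hasFDerivWithinAt_const (1 : ℝ) x _).congr (fun y hy => by simp [hnorm y hy])
        (by simp [hnorm x hx])
    have h3 := (hBu x hx).eq h1 h2
    obtain ⟨z, hz⟩ : ∃ z, D z = r x := by
      have hu : IsUnit (LinearMap.det (D : E →ₗ[ℝ] E)) := isUnit_iff_ne_zero.2 hne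
      obtain ⟨z, hz⟩ := (LinearMap.equivOfIsUnitDet hu).surjective (r x)
      exact ⟨z, by simpa using hz⟩
    have h4 := DFunLike.congr_fun h3 z
    simp [hz, hnorm x hx] at h4
  rw [setIntegral_congr_fun isClosed_closedBall.measurableSet (g := fun _ => (0 : ℝ)) hdet,
    integral_zero] at h
  have hpos : 0 < (volume : Measure E).real (closedBall 0 1) :=
    ENNReal.toReal_pos (measure_closedBall_pos _ _ one_pos).ne'
      (isCompact_closedBall _ _).measure_lt_top.ne
  exact hpos.ne h

/-- Without a fixed point, following the ray from `h x` through `x` to the sphere is a `C¹`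
retraction. The larger root `lam` of `‖x + λ G x‖ ^ 2 = 1` gives the exit point. The strict bound on
`h` makes the discriminant positive on the sphere too, so its square root is `C¹`. -/
theorem exists_fixedPoint_of_contDiff {h : E → E} (hh : ContDiff ℝ 1 h)
    (hmaps : ∀ x ∈ closedBall (0 : E) 1, ‖h x‖ < 1) : ∃ x ∈ closedBall (0 : E) 1, h x = x := by
  by_contra! hfix
  set G : E → E := fun x => x - h x with hG
  have hG0 : ∀ x ∈ closedBall (0 : E) 1, 0 < ‖G x‖ ^ 2 := fun x hx => by
    have : G x ≠ 0 := sub_ne_zero.2 (hfix x hx).symm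
    positivity
  have hGs : ContDiff ℝ 1 G := contDiff_id.sub hh
  have hsphere : ∀ x : E, ‖x‖ = 1 → 0 < ⟪x, G x⟫ := by
    intro x hx
    have h1 : ⟪x, h x⟫ < 1 := by
      calc ⟪x, h x⟫ ≤ ‖x‖ * ‖h x‖ := real_inner_le_norm _ _
        _ < 1 := by rw [hx, one_mul]; exact hmaps x (by simp [hx])
    simp only [hG, inner_sub_right, real_inner_self_eq_norm_sq, hx]
    linarith
  set disc : E → ℝ := fun x => ⟪x, G x⟫ ^ 2 + ‖G x‖ ^ 2 * (1 - ‖x‖ ^ 2) with hdisc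
  have hdisc0 : ∀ x ∈ closedBall (0 : E) 1, 0 < disc x := by
    intro x hx
    have hx1 : ‖x‖ ≤ 1 := by simpa using hx
    rcases hx1.lt_or_eq with hlt | heq
    · have : 0 < 1 - ‖x‖ ^ 2 := by nlinarith [norm_nonneg x]
      have := mul_pos (hG0 x hx) this
      simp only [hdisc]
      nlinarith [sq_nonneg ⟪x, G x⟫]
    · have := hsphere x heq
      simp only [hdisc, heq]
      nlinarith
  set lam : E → ℝ := fun x => (-⟪x, G x⟫ + √(disc x)) / ‖G x‖ ^ 2 with hlam
  have hdiscs : ContDiff ℝ 1 disc :=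
    ((contDiff_id.inner ℝ hGs).pow 2).add
      ((hGs.norm_sq ℝ).mul (contDiff_const.sub (contDiff_id.norm_sq ℝ)))
  have hlams : ContDiffOn ℝ 1 lam (closedBall 0 1) := by
    refine ContDiffOn.div ?_ (hGs.norm_sq ℝ).contDiffOn fun x hx => (hG0 x hx).ne'
    exact (contDiff_id.inner ℝ hGs).neg.contDiffOn.add
      (hdiscs.contDiffOn.sqrt fun x hx => (hdisc0 x hx).ne')
  refine not_contDiffOn_retraction_closedBall (r := fun x => x + lam x • G x)
    (contDiffOn_id.add (hlams.smul hGs.contDiffOn)) (fun x hx => ?_) (fun x hx => ?_)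
  · have hsq : ‖x + lam x • G x‖ ^ 2 = 1 := by
      rw [norm_add_sq_real, norm_smul, mul_pow, Real.norm_eq_abs, sq_abs, real_inner_smul_right]
      have hg := (hG0 x hx).ne'
      have hs := Real.sq_sqrt (hdisc0 x hx).le
      have hl : lam x * ‖G x‖ ^ 2 = -⟪x, G x⟫ + √(disc x) := div_mul_cancel₀ _ hg
      have hs' : (lam x * ‖G x‖ ^ 2 + ⟪x, G x⟫) ^ 2 =
          ⟪x, G x⟫ ^ 2 + ‖G x‖ ^ 2 * (1 - ‖x‖ ^ 2) := by
        rw [hl, neg_add_cancel_comm, hs]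
      apply mul_left_cancel₀ hg
      linear_combination hs'
    exact (pow_eq_one_iff_of_nonneg (norm_nonneg _) two_ne_zero).1 hsq
  · have hx1 : ‖x‖ = 1 := by simpa using hx
    have : lam x = 0 := by
      simp only [hlam, hdisc, hx1]
      simp [Real.sqrt_sq (hsphere x hx1).le]
    simp [this]

/-- **Brouwer's fixed point theorem** for the closed unit ball. -/
theorem exists_fixedPoint_closedBall {f : E → E} (hf : ContinuousOn f (closedBall 0 1))
    (hmaps : MapsTo f (closedBall 0 1) (closedBall 0 1)) :
    ∃ x ∈ closedBall (0 : E) 1, f x = x := by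
  by_contra! hfix
  have hBc : IsCompact (closedBall (0 : E) 1) := isCompact_closedBall _ _
  obtain ⟨x₀, hx₀, hmin⟩ := hBc.exists_isMinOn ⟨0, by simp⟩ (hf.sub continuousOn_id).norm
  set m := ‖f x₀ - x₀‖ with hm
  have hm0 : 0 < m := norm_pos_iff.2 (sub_ne_zero.2 (hfix x₀ hx₀))
  have hle : ∀ x ∈ closedBall (0 : E) 1, m ≤ ‖f x - x‖ := fun x hx => hmin hx
  obtain ⟨g, hg⟩ := ContinuousMap.exists_restrict_eq (isClosed_closedBall (x := (0 : E)) (ε := 1))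
    ⟨_, hf.domRestrict⟩
  have hgf : ∀ x ∈ closedBall (0 : E) 1, g x = f x := fun x hx =>
    DFunLike.congr_fun hg ⟨x, hx⟩
  -- Approximating within `m / 4` and rescaling by `(1 + m / 4)⁻¹` gives a `C¹` map into the open
  -- ball. At its fixed point `f` moves `x` by less than `m / 2`, against minimality of `m`.
  have hη : 0 < m / 4 := by positivity
  obtain ⟨k, hk, hkg, -⟩ := g.continuous.exists_contDiff_approx 1
    (continuous_const (y := m / 4)) (fun _ => hη)
  have hkf : ∀ x ∈ closedBall (0 : E) 1, ‖k x - f x‖ < m / 4 := fun x hx => by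
    rw [← dist_eq_norm, ← hgf x hx]
    exact hkg x
  have hk1 : ∀ x ∈ closedBall (0 : E) 1, ‖k x‖ < 1 + m / 4 := fun x hx => by
    have h1 : ‖f x‖ ≤ 1 := by simpa using hmaps hx
    have := norm_le_norm_add_norm_sub (f x) (k x)
    rw [norm_sub_rev] at this
    linarith [hkf x hx]
  have hpos : 0 < 1 + m / 4 := by positivity
  obtain ⟨x, hx, hxk⟩ := exists_fixedPoint_of_contDiff (h := fun x => (1 + m / 4)⁻¹ • k x)
    (hk.const_smul _) fun x hx => by
      rw [norm_smul, Real.norm_of_nonneg (by positivity), inv_mul_lt_iff₀ hpos, mul_one]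
      exact hk1 x hx
  have hkx : k x = (1 + m / 4) • x := by
    rw [← hxk, smul_smul, mul_inv_cancel₀ hpos.ne', one_smul, hxk]
  have hx1 : ‖x‖ ≤ 1 := by simpa using hx
  have h1 : ‖k x - x‖ ≤ m / 4 := by
    rw [hkx, add_smul, one_smul, add_sub_cancel_left, norm_smul, Real.norm_of_nonneg hη.le]
    exact mul_le_of_le_one_right hη.le hx1
  have h2 : ‖f x - x‖ ≤ ‖k x - f x‖ + ‖k x - x‖ := by
    rw [norm_sub_rev (k x) (f x)]
    exact norm_sub_le_norm_sub_add_norm_sub _ _ _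
  linarith [hle x hx, hkf x hx]

/-- A continuous self-map of `E` that moves the points of a closed ball about `0` by at most its
radius has a zero in that ball. -/
theorem exists_zero_of_norm_sub_le {g : E → E} {R : ℝ} (hR : 0 < R)
    (hg : ContinuousOn g (closedBall 0 R)) (hclose : ∀ x ∈ closedBall (0 : E) R, ‖g x - x‖ ≤ R) :
    ∃ x ∈ closedBall (0 : E) R, g x = 0 := by
  have hscale : MapsTo (fun x : E => R • x) (closedBall 0 1) (closedBall 0 R) := fun x hx => by
    simp only [mem_closedBall, dist_zero_right, norm_smul, Real.norm_of_nonneg hR.le] at hx ⊢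
    nlinarith
  obtain ⟨x, hx, hfx⟩ := exists_fixedPoint_closedBall (f := fun x => x - R⁻¹ • g (R • x))
    (continuousOn_id.sub ((hg.comp (continuous_const_smul R).continuousOn hscale).const_smul _))
    fun x hx => by
      have h := hclose _ (hscale hx)
      have : x - R⁻¹ • g (R • x) = -(R⁻¹ • (g (R • x) - R • x)) := by
        rw [smul_sub, inv_smul_smul₀ hR.ne', neg_sub]
      rw [mem_closedBall, dist_zero_right]
      beta_reduce
      rw [this, norm_neg, norm_smul,
        Real.norm_of_nonneg (by positivity), inv_mul_le_iff₀ hR, mul_one]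
      exact h
  refine ⟨R • x, hscale hx, ?_⟩
  simpa [hR.ne'] using hfx

end Brouwer

/-! ### Definite splitting of the Hessian and second-order Taylor expansion. -/

section Hessian

open Set Metric Filter Topology
open scoped RealInnerProductSpace

variable {E : Type*} [NormedAddCommGroup E] [InnerProductSpace ℝ E] [FiniteDimensional ℝ E]

/-- A nondegenerate symmetric bilinear form is negative definite on some subspace and positive
definite on its orthogonal complement. -/
theorem exists_submodule_neg_pos_definite (H : E →L[ℝ] E →L[ℝ] ℝ) (hsymm : ∀ v w, H v w = H w v)
    (hnd : ∀ v, (∀ w, H v w = 0) → v = 0) :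
    ∃ (N : Submodule ℝ E) (c : ℝ), 0 < c ∧ (∀ v ∈ N, H v v ≤ -(c * ‖v‖ ^ 2)) ∧
      ∀ v ∈ Nᗮ, c * ‖v‖ ^ 2 ≤ H v v := by
  set T : E →L[ℝ] E := InnerProductSpace.continuousLinearMapOfBilin (𝕜 := ℝ) H
  have hT : ∀ v w, ⟪T v, w⟫ = H v w := fun v w =>
    InnerProductSpace.continuousLinearMapOfBilin_apply (𝕜 := ℝ) H v w
  have hTs : (T : E →ₗ[ℝ] E).IsSymmetric := fun v w => by
    rw [real_inner_comm _ v]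
    simp only [ContinuousLinearMap.coe_coe, hT]
    exact hsymm v w
  set b := hTs.eigenvectorBasis rfl
  set l := hTs.eigenvalues rfl
  have hb : ∀ i, T (b i) = l i • b i := fun i => hTs.apply_eigenvectorBasis rfl i
  have hl : ∀ i, l i ≠ 0 := fun i hi => by
    refine b.toBasis.ne_zero i ?_
    rw [OrthonormalBasis.coe_toBasis]
    exact hnd _ fun w => by rw [← hT, hb, hi, zero_smul, inner_zero_left]
  have hH : ∀ v, H v v = ∑ i, l i * ⟪b i, v⟫ ^ 2 := fun v => by
    rw [← hT, ← b.sum_inner_mul_inner]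
    refine Finset.sum_congr rfl fun i _ => ?_
    rw [hT, hsymm, ← hT, hb, real_inner_smul_left]
    ring
  have hsq : ∀ v, ‖v‖ ^ 2 = ∑ i, ⟪b i, v⟫ ^ 2 := fun v => by
    rw [← b.sum_sq_norm_inner_right]
    simp
  obtain ⟨c, hc, hcl⟩ : ∃ c : ℝ, 0 < c ∧ ∀ i, c ≤ |l i| := by
    rcases isEmpty_or_nonempty (Fin (Module.finrank ℝ E)) with h | h
    · exact ⟨1, one_pos, fun i => h.elim i⟩
    · obtain ⟨i, hi⟩ := Finite.exists_min fun i => |l i|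
      exact ⟨|l i|, abs_pos.2 (hl i), hi⟩
  -- `N` is spanned by the eigenvectors with negative eigenvalue, and `c` bounds all `|l i|` from
  -- below.
  refine ⟨Submodule.span ℝ (b '' {i | l i < 0}), c, hc, fun v hv => ?_, fun v hv => ?_⟩
  · have hperp : ∀ i, 0 < l i → ⟪b i, v⟫ = 0 := fun i hi => by
      induction hv using Submodule.span_induction with
      | mem x hx =>
        obtain ⟨j, hj, rfl⟩ := hx
        exact b.orthonormal.inner_eq_zero (by rintro rfl; exact lt_asymm hi hj)
      | zero => exact inner_zero_right _
      | add x y _ _ hx hy => rw [inner_add_right, hx, hy, add_zero]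
      | smul a x _ hx => rw [real_inner_smul_right, hx, mul_zero]
    rw [hH, hsq, Finset.mul_sum, ← Finset.sum_neg_distrib]
    refine Finset.sum_le_sum fun i _ => ?_
    rcases (hl i).lt_or_gt with h | h
    · have := hcl i
      rw [abs_of_neg h] at this
      nlinarith [sq_nonneg ⟪b i, v⟫]
    · simp [hperp i h]
  · have hperp : ∀ i, l i < 0 → ⟪b i, v⟫ = 0 := fun i hi =>
      (Submodule.mem_orthogonal _ _).1 hv _ (Submodule.subset_span ⟨i, hi, rfl⟩)
    rw [hH, hsq, Finset.mul_sum]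
    refine Finset.sum_le_sum fun i _ => ?_
    rcases (hl i).lt_or_gt with h | h
    · simp [hperp i h]
    · have := hcl i
      rw [abs_of_pos h] at this
      exact mul_le_mul_of_nonneg_right this (sq_nonneg _)

/-- Second-order Taylor expansion at a critical point. -/
theorem ContDiffAt.eventually_abs_sub_hessian_le {E : Type*} [NormedAddCommGroup E]
    [NormedSpace ℝ E] {f : E → ℝ} {z : E} (hf : ContDiffAt ℝ 2 f z) (hz : fderiv ℝ f z = 0)
    {ε : ℝ} (hε : 0 < ε) :
    ∀ᶠ v in 𝓝 (0 : E),
      |f (z + v) - f z - 1 / 2 * fderiv ℝ (fderiv ℝ f) z v v| ≤ ε * ‖v‖ ^ 2 := by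
  set H := fderiv ℝ (fderiv ℝ f) z with hH
  have hsymm : ∀ v w, H v w = H w v := fun v w =>
    (hf.isSymmSndFDerivAt (by simp)).eq v w
  have hd : HasFDerivAt (fderiv ℝ f) H z :=
    ((hf.fderiv_right (m := 1) (by norm_num)).differentiableAt one_ne_zero).hasFDerivAt
  have h1 : ∀ᶠ y in 𝓝 z, DifferentiableAt ℝ f y :=
    (hf.eventually (by simp)).mono fun y hy => hy.differentiableAt two_ne_zero
  have h2 : ∀ᶠ y in 𝓝 z, ‖fderiv ℝ f y - H (y - z)‖ ≤ ε * ‖y - z‖ := by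
    simpa [hz] using hd.isLittleO.def hε
  obtain ⟨δ, hδ, hball⟩ := Metric.eventually_nhds_iff_ball.1 (h1.and h2)
  filter_upwards [ball_mem_nhds (0 : E) hδ] with v hv
  have hv' : ‖v‖ < δ := by simpa using hv
  have hmem : ∀ y ∈ closedBall z ‖v‖, y ∈ ball z δ := fun y hy =>
    lt_of_le_of_lt (mem_closedBall.1 hy) hv'
  have hq : ∀ y ∈ closedBall z ‖v‖, HasFDerivWithinAt
      (fun y => f y - 1 / 2 * H (y - z) (y - z)) (fderiv ℝ f y - H (y - z))
      (closedBall z ‖v‖) y := by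
    intro y hy
    have hs : HasFDerivAt (fun y : E => y - z) (ContinuousLinearMap.id ℝ E) y :=
      (hasFDerivAt_id y).sub_const z
    have hHy := ((H.hasFDerivAt.comp y hs).clm_apply hs).const_mul (1 / 2 : ℝ)
    refine ((((hball y (hmem y hy)).1.hasFDerivAt).sub hHy).congr_fderiv ?_).hasFDerivWithinAt
    ext w
    simp [hsymm w]
    ring
  -- Mean value inequality for `f` minus its quadratic part, whose derivative is at most `ε * ‖v‖`
  -- on this ball.
  have hle := (convex_closedBall z ‖v‖).norm_image_sub_le_of_norm_hasFDerivWithin_le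
    (C := ε * ‖v‖) hq (fun y hy => ((hball y (hmem y hy)).2).trans (by
      gcongr
      exact mem_closedBall_iff_norm.1 hy))
    (mem_closedBall_self (norm_nonneg v)) (y := z + v) (by simp)
  simp only [add_sub_cancel_left, sub_self, map_zero, mul_zero, sub_zero, Real.norm_eq_abs] at hle
  convert hle using 1
  · congr 1
    ring
  · ring

end Hessian

/-! ### Zeros of `df` at extrema and at nondegenerate critical points. -/

namespace ContinuousClosedOneForm

open Set Metric Filter Topology

theorem IsGradientLike.apply_lt {X : Type*} [TopologicalSpace X] {f : C(X, ℝ)} {φ : Flow ℝ X}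
    (h : (d f).IsGradientLike φ) {x : X} (hx : ¬ IsFixedPoint φ x) {s t : ℝ} (hst : s < t) :
    f (φ t x) < f (φ s x) :=
  h ⊤ rfl x hx s t hst fun _ _ => trivial

theorem isZero_d_of_isLocalMax_or_isLocalMin {X : Type*} [TopologicalSpace X] {f : C(X, ℝ)} {p : X}
    (hp : IsLocalMax f p ∨ IsLocalMin f p) : (d f).IsZero p := by
  intro φ hφ
  by_contra hfix
  have hc : Tendsto (fun t : ℝ => φ t p) (𝓝 0) (𝓝 p) := by
    have : Continuous fun t : ℝ => φ t p := φ.continuous continuous_id continuous_const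
    simpa using this.tendsto 0
  rcases hp with hp | hp
  · obtain ⟨t, ht, ht0⟩ := (((hc.eventually hp).filter_mono nhdsWithin_le_nhds).and
      (self_mem_nhdsWithin (s := Iio (0 : ℝ)))).exists
    have := hφ.apply_lt hfix (mem_Iio.1 ht0)
    rw [φ.map_zero_apply] at this
    exact this.not_ge ht
  · obtain ⟨t, ht, ht0⟩ := (((hc.eventually hp).filter_mono nhdsWithin_le_nhds).and
      (self_mem_nhdsWithin (s := Ioi (0 : ℝ)))).exists
    have := hφ.apply_lt hfix (mem_Ioi.1 ht0)
    rw [φ.map_zero_apply] at this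
    exact this.not_ge ht

/-- If, in some chart around `p`, the function `f` has a maximum at `p` along a linear subspace and
a minimum at `p` along its orthogonal complement, then `p` is a zero of `df`. -/
theorem isZero_d_of_chart {X E : Type*} [TopologicalSpace X] [T2Space X] [NormedAddCommGroup E]
    [InnerProductSpace ℝ E] [FiniteDimensional ℝ E] {f : C(X, ℝ)} {p : X}
    (e : OpenPartialHomeomorph X E) (hp : p ∈ e.source) (N : Submodule ℝ E)
    (hN : ∀ᶠ v in 𝓝 (0 : E), v ∈ N → f (e.symm (e p + v)) ≤ f p)
    (hP : ∀ᶠ v in 𝓝 (0 : E), v ∈ Nᗮ → f p ≤ f (e.symm (e p + v))) : (d f).IsZero p := by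
  intro φ hφ
  by_contra hfix
  obtain ⟨τ, hτ⟩ : ∃ τ, φ τ p ≠ p := by simpa [IsFixedPoint] using hfix
  set s : E → X := fun v => e.symm (e p + v) with hs
  have hs0 : s 0 = p := by simp [hs, e.left_inv hp]
  have hscont : ∀ v, e p + v ∈ e.target → ContinuousAt s v := fun v hv =>
    ContinuousAt.comp (g := e.symm) (f := fun v => e p + v)
      (e.continuousAt_symm hv) (by fun_prop)
  have htarget : ∀ᶠ v in 𝓝 (0 : E), e p + v ∈ e.target := by
    have hc : ContinuousAt (fun v : E => e p + v) 0 := by fun_prop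
    exact hc.eventually_mem (e.open_target.mem_nhds (by simpa using e.map_source hp))
  -- Being moved by the single time `τ` is an open condition because `X` is Hausdorff.
  have hmoves : ∀ᶠ v in 𝓝 (0 : E), φ τ (s v) ≠ s v := by
    have hopen : IsOpen {x | φ τ x ≠ x} :=
      isOpen_ne_fun (φ.continuous continuous_const continuous_id) continuous_id
    exact (hscont 0 htarget.self_of_nhds).eventually_mem
      (hopen.mem_nhds (by rw [hs0]; exact hτ))
  obtain ⟨δ, hδ, hball⟩ :=
    Metric.eventually_nhds_iff_ball.1 (((hN.and hP).and htarget).and hmoves)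
  -- Points of norm at most `r` displaced by less than `r` stay within `2 * r < δ`, where both slice
  -- inequalities hold.
  set r := δ / 3 with hr
  have hr0 : 0 < r := by positivity
  have hsub : ∀ v : E, ‖v‖ ≤ 2 * r → v ∈ ball (0 : E) δ := fun v hv => by
    rw [mem_ball_zero_iff]
    linarith
  have hsub' : ∀ v ∈ closedBall (0 : E) r, v ∈ ball (0 : E) δ := fun v hv =>
    hsub v ((mem_closedBall_zero_iff.1 hv).trans (by linarith))
  -- Compactness of the ball makes one small time work for all `v`.
  have hclose : ∀ᶠ t in 𝓝 (0 : ℝ), ∀ v ∈ closedBall (0 : E) r,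
      φ t (s v) ∈ e.source ∧ ‖e (φ t (s v)) - e p - v‖ < r := by
    refine (isCompact_closedBall (0 : E) r).eventually_forall_of_forall_eventually fun v hv => ?_
    have hvt : e p + v ∈ e.target := (hball v (hsub' v hv)).1.2
    have hsource : s v ∈ e.source := e.map_target hvt
    have hφc : ContinuousAt (fun q : ℝ × E => φ q.1 (s q.2)) (0, v) := by
      have h1 : Continuous fun q : ℝ × X => φ q.1 q.2 := φ.continuous continuous_fst continuous_snd
      have h2 : ContinuousAt (fun q : ℝ × E => (q.1, s q.2)) (0, v) :=
        continuousAt_fst.prodMk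
          (ContinuousAt.comp (g := s) (f := Prod.snd) (hscont v hvt) continuousAt_snd)
      exact ContinuousAt.comp (g := fun q : ℝ × X => φ q.1 q.2) h1.continuousAt h2
    have hval : φ 0 (s v) = s v := φ.map_zero_apply _
    have hec : ContinuousAt (fun q : ℝ × E => ‖e (φ q.1 (s q.2)) - e p - q.2‖) (0, v) := by
      have h3 : ContinuousAt (fun q : ℝ × E => e (φ q.1 (s q.2))) (0, v) :=
        ContinuousAt.comp (g := e) (f := fun q : ℝ × E => φ q.1 (s q.2))
          (e.continuousAt (by simpa [hval] using hsource)) hφc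
      exact ((h3.sub continuousAt_const).sub continuousAt_snd).norm
    refine (hφc.eventually_mem (e.open_source.mem_nhds (by simpa [hval] using hsource))).and
      (hec.eventually_lt_const ?_)
    simpa [hval, hs, e.right_inv hvt] using hr0
  obtain ⟨t, ht, ht0⟩ := ((hclose.filter_mono nhdsWithin_le_nhds).and
    (self_mem_nhdsWithin (s := Ioi (0 : ℝ)))).exists
  have hmem : ∀ x ∈ closedBall (0 : N) r, (x : E) ∈ closedBall (0 : E) r := fun x hx => by
    simpa using hx
  -- Brouwer inside `N`: some point of the `N`-slice flows into the `Nᗮ`-slice.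
  obtain ⟨x, hx, hgx⟩ := exists_zero_of_norm_sub_le hr0
    (g := fun x : N => N.orthogonalProjectionOnto (e (φ t (s x)) - e p)) (fun x hx => by
      have hx' := hmem x hx
      have h1 : ContinuousAt (fun x : N => s x) x :=
        ContinuousAt.comp (g := s) (f := ((↑) : N → E))
          (hscont _ (hball _ (hsub' _ hx')).1.2) continuous_subtype_val.continuousAt
      have h2 : ContinuousAt (fun x : N => φ t (s x)) x :=
        ContinuousAt.comp (g := fun y => φ t y)
          (φ.continuous continuous_const continuous_id).continuousAt h1
      have h3 : ContinuousAt (fun x : N => e (φ t (s x))) x :=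
        ContinuousAt.comp (g := e) (f := fun x : N => φ t (s x)) (e.continuousAt (ht _ hx').1) h2
      exact (N.orthogonalProjectionOnto.continuous.continuousAt.comp
        (h3.sub continuousAt_const)).continuousWithinAt)
    (fun x hx => by
      have h1 : N.orthogonalProjectionOnto (e (φ t (s x)) - e p) - x =
          N.orthogonalProjectionOnto (e (φ t (s x)) - e p - x) := by
        rw [map_sub _ (e (φ t (s x)) - e p), Submodule.orthogonalProjectionOnto_mem_subspace_eq_self]
      rw [h1]
      exact (N.norm_orthogonalProjectionOnto_apply_le _).trans (ht _ (hmem x hx)).2.le)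
  have hx' := hmem x hx
  have hxnorm : ‖(x : E)‖ ≤ r := mem_closedBall_zero_iff.1 hx'
  obtain ⟨⟨⟨hNx, -⟩, -⟩, hmx⟩ := hball _ (hsub' _ hx')
  obtain ⟨hsrc, hdist⟩ := ht _ hx'
  set y := e (φ t (s x)) - e p with hy
  have hyball : y ∈ ball (0 : E) δ := hsub y (by
    have := norm_le_norm_add_norm_sub' y (x : E)
    linarith)
  have h1 : f p ≤ f (e.symm (e p + y)) := (hball y hyball).1.1.2
    (N.orthogonalProjectionOnto_eq_zero_iff.1 hgx)
  rw [hy, add_sub_cancel, e.left_inv hsrc] at h1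
  have h2 : f (φ t (s x)) < f (φ 0 (s x)) := hφ.apply_lt (fun h => hmx (h τ)) ht0
  rw [φ.map_zero_apply] at h2
  linarith [hNx x.2]

theorem isZero_d_of_isNondegenerateCriticalPoint {n : ℕ} {M : Type*} [TopologicalSpace M]
    [T2Space M] [ChartedSpace (EuclideanSpace ℝ (Fin n)) M] {f : C(M, ℝ)} {p : M}
    (hf : ContMDiffAt (𝓡 n) 𝓘(ℝ, ℝ) 2 f p) (hp : IsNondegenerateCriticalPoint n f p) :
    (d f).IsZero p := by
  set e := chartAt (EuclideanSpace ℝ (Fin n)) p with he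
  obtain ⟨hcrit, hnd⟩ := hp
  have hsmooth : ContDiffAt ℝ 2 (f ∘ e.symm) (e p) := by
    simpa [contMDiffAt_iff, contDiffWithinAt_univ, Function.comp_def, chartAt_self_eq] using (contMDiffAt_iff.1 hf).2
  have hcrit' : fderiv ℝ (f ∘ e.symm) (e p) = 0 := by
    have h := (hf.mdifferentiableAt two_ne_zero).mfderiv
    rw [hcrit] at h
    simp only [writtenInExtChartAt, fderivWithin_univ, mfld_simps] at h
    exact h.symm
  set H := fderiv ℝ (fderiv ℝ (f ∘ e.symm)) (e p) with hH
  have hHess : chartHessian (f : M → ℝ) p = H := by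
    simp [chartHessian, hH, he]
  rw [hHess] at hnd
  obtain ⟨N, c, hc, hneg, hpos⟩ := exists_submodule_neg_pos_definite H
    (fun v w => (hsmooth.isSymmSndFDerivAt (by simp)).eq v w) hnd
  -- The error `c / 2 * ‖v‖ ^ 2` is just absorbed by half the definite form, at least `c / 2 * ‖v‖ ^
  -- 2` in size on `N` and on `Nᗮ`.
  have htaylor := hsmooth.eventually_abs_sub_hessian_le hcrit' (ε := c / 2) (by positivity)
  have hbase : (f ∘ e.symm) (e p) = f p := by
    simp [he]
  rw [hbase] at htaylor
  refine isZero_d_of_chart e (mem_chart_source _ p) N ?_ ?_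
  · filter_upwards [htaylor] with v hv hvN
    have := (abs_le.1 hv).2
    have := hneg v hvN
    simp only [Function.comp_apply] at *
    linarith
  · filter_upwards [htaylor] with v hv hvN
    have := (abs_le.1 hv).1
    have := hpos v hvN
    simp only [Function.comp_apply] at *
    linarith

end ContinuousClosedOneForm

theorem mainTheorem5 :
    (∀ (n : ℕ) (M : Type*) [TopologicalSpace M] [T2Space M] [SecondCountableTopology M]
      [ChartedSpace (EuclideanSpace ℝ (Fin n)) M] [IsManifold (𝓡 n) ∞ M]
      (f : M → ℝ) (hf : IsMorseFunction n f) (p : M),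
      IsNondegenerateCriticalPoint n f p →
        (ContinuousClosedOneForm.d ⟨f, hf.smooth.continuous⟩).IsZero p) ∧
    (∀ (X : Type*) [TopologicalSpace X] (f : C(X, ℝ)) (p : X),
      IsLocalMax f p ∨ IsLocalMin f p → (ContinuousClosedOneForm.d f).IsZero p) := by
  refine ⟨fun n M _ _ _ _ _ f hf p hp => ?_, fun X _ f p hp =>
    ContinuousClosedOneForm.isZero_d_of_isLocalMax_or_isLocalMin hp⟩
  exact ContinuousClosedOneForm.isZero_d_of_isNondegenerateCriticalPoint
    (f := ⟨f, hf.smooth.continuous⟩)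
    ((hf.smooth p).of_le ENat.LEInfty.out) hp
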